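/- Let $n\ge 1$ and let $C\subset\mathbb R^n$ be a closed convex cone that contains no line and has nonempty interior. Put $C^\circ=\{y:\langle x,y\rangle\le 0 \text{ for all } x\in C\}$ and $\Omega=\operatorname{int}C^\circ\cap S^{n-1}$. Let $e_1,\dots,e_n$ be an orthonormal basis of $\mathbb R^n$ such that $u_*=-e_1$ lies in $\operatorname{int}C$ and, for some $\xi>0$, $\langle u,u_*\rangle>\xi$ for all $u\in C\cap S^{n-1}$ and $\langle v,u_*\rangle<-\xi$ for all $v\in C^\circ\cap S^{n-1}$. Write points of $\mathbb R^n$ in this basis as $(t,x)\in\mathbb R\times\mathbb R^{n-1}$, and let $\Phi(x)=(1,x)/\sqrt{1+|x|^2}$ for $x\in\mathbb R^{n-1}$. A nonempty closed convex set $K\subset\mathbb R^n$ is a pseudo cone if $\lambda x\in K$ for all $x\in K$, $\lambda\ge 1$. It is $C$-asymptotic if it is a pseudo cone, its recession cone $\{y: x+\lambda y\in K\text{ for all }x\in K,\ \lambda\ge 1\}$ equals $C$, and $\operatorname{dist}(x,\partial C)\to 0$ as $|x|\to\infty$ with $x\in\partial K$. Let $h_K(y)=\sup_{x\in K}\langle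 x,y\rangle$ for $y\in C^\circ$, and for Borel $\eta\subset\Omega$ let $$S_K(\eta)=\mathcal H^{n-1}\big(\{x\in\partial K:\langle x,v\rangle=h_K(v)\text{ for some }v\in\eta\}\big).$$ Let $\mu$ be a locally finite Borel measure on $\Omega$, and set $\widetilde\mu(\widetilde\eta)=\int_{\Phi(\widetilde\eta)}|\langle v,e_1\rangle|\,d\mu(v)$ for Borel $\widetilde\eta\subset\Phi^{-1}(\Omega)$. If $K$ is $C$-asymptotic and $S_K=\mu$ on all Borel subsets of $\Omega$, then the function $$u:\overline{\Phi^{-1}(\Omega)}\to\mathbb R,\qquad u(x)=h_K(1,x),$$ is convex and continuous, satisfies $u=0$ on $\partial(\Phi^{-1}(\Omega))$, and solves $\mathcal M_u=\widetilde\mu$ on $\Phi^{-1}(\Omega)$, that is, for every Borel set $\Xi\subset\Phi^{-1}(\Omega)$, $$\mathcal M_u(\Xi):=\mathcal H^{n-1}\Big(\bigcup_{x\in\Xi}\partial u(x)\Big)=\widetilde\mu(\Xi),$$ where $\partial u(x)=\{p\in\mathbb R^{n-1}:u(z)\ge u(x)+\langle p,z-x\rangle\text{ for all }z\in\overline{\Phi^{-1}(\Omega)}\}$.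 -/

import Mathlib

open MeasureTheory Filter Topology
open scoped ENNReal RealInnerProductSpace

noncomputable section

namespace PseudoCone

section General

variable {E : Type*} [NormedAddCommGroup E] [InnerProductSpace ℝ E]

/-- The set contains no line that is infinite in both directions. -/
def ContainsNoLine (C : Set E) : Prop :=
  ∀ x v : E, v ≠ 0 → ∃ t : ℝ, x + t • v ∉ C

/-- The dual cone `C° = {y : ⟪x, y⟫ ≤ 0 for all x ∈ C}` (with the sign convention of the polar). -/
def dualCone (C : Set E) : Set E :=
  {y | ∀ x ∈ C, ⟪x, y⟫ ≤ 0}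

/-- `Ω = int C° ∩ S^{n-1}`. -/
def Omega (C : Set E) : Set E :=
  interior (dualCone C) ∩ Metric.sphere 0 1

/-- A pseudo cone: a nonempty closed convex set stable under dilations by factors `≥ 1`. -/
structure IsPseudoCone (K : Set E) : Prop where
  nonempty : K.Nonempty
  isClosed : IsClosed K
  convex : Convex ℝ K
  smul_mem : ∀ x ∈ K, ∀ r : ℝ, 1 ≤ r → r • x ∈ K

/-- The recession cone of `K`. -/
def recessionCone (K : Set E) : Set E :=
  {y | ∀ x ∈ K, ∀ r : ℝ, 1 ≤ r → x + r • y ∈ K}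

/-- `K` is `C`-pseudo: a pseudo cone whose recession cone is `C`. -/
def IsCPseudo (C K : Set E) : Prop :=
  IsPseudoCone K ∧ recessionCone K = C

/-- `K` is `C`-asymptotic: it is `C`-pseudo, and `dist(x, ∂C) → 0` as `|x| → ∞`, `x ∈ ∂K`. -/
def IsCAsymptotic (C K : Set E) : Prop :=
  IsCPseudo C K ∧
    Tendsto (fun x => Metric.infDist x (frontier C))
      (Bornology.cobounded E ⊓ 𝓟 (frontier K)) (𝓝 0)

/-- The support function `h_K(y) = sup_{x ∈ K} ⟪x, y⟫`. If `K` is `C`-pseudo then `K ⊆ C`, so that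
for `y ∈ C°` this is the supremum of a nonempty set of reals bounded above by `0`; it is used only
for such `y`. -/
def supportFunction (K : Set E) (y : E) : ℝ :=
  sSup ((fun x => ⟪x, y⟫) '' K)

/-- The inverse Gauss image `τ_K(η)`. -/
def inverseGaussImage (K η : Set E) : Set E :=
  {x | x ∈ frontier K ∧ ∃ v ∈ η, ⟪x, v⟫ = supportFunction K v}

/-- The surface area measure, `S_K(η) = ℋ^d(τ_K(η))` with `d = n - 1`, for Borel sets `η ⊆ Ω`;
here `μHE[d]` is Mathlib's (Euclidean normalized) `d`-dimensional Hausdorff measure. -/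
def surfaceArea [MeasurableSpace E] [BorelSpace E] (d : ℕ) (K η : Set E) : ℝ≥0∞ :=
  μHE[d] (inverseGaussImage K η)

/-- The subdifferential at `x` of a function `u` with domain `Λ`. -/
def subdifferential (Λ : Set E) (u : E → ℝ) (x : E) : Set E :=
  {p | ∀ z ∈ Λ, u x + ⟪p, z - x⟫ ≤ u z}

end General

section Coordinates

variable {m : ℕ}

/-- The Monge-Ampère measure of a function `u` with domain `Λ ⊆ ℝ^m`:
`M_u(Ξ) = ℋ^m(∂u(Ξ))`, where `∂u(Ξ) = ⋃_{x ∈ Ξ} ∂u(x)`, for Borel sets `Ξ ⊆ Λ`. -/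
def mongeAmpere (Λ : Set (EuclideanSpace ℝ (Fin m))) (u : EuclideanSpace ℝ (Fin m) → ℝ)
    (Ξ : Set (EuclideanSpace ℝ (Fin m))) : ℝ≥0∞ :=
  μHE[m] (⋃ x ∈ Ξ, subdifferential Λ u x)

/-- The choice of coordinates: `e` is an orthonormal basis whose first vector is `e_1 = -u_*`,
where `u_*` is a unit vector in the interior of `C` such that, for some `ξ > 0`,
`⟪u, u_*⟫ > ξ` on `C ∩ S^{n-1}` and `⟪v, u_*⟫ < -ξ` on `C° ∩ S^{n-1}`. -/
def IsAdaptedBasis (C : Set (EuclideanSpace ℝ (Fin (m + 1))))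
    (e : OrthonormalBasis (Fin (m + 1)) ℝ (EuclideanSpace ℝ (Fin (m + 1)))) : Prop :=
  -e 0 ∈ interior C ∧
    ∃ ξ : ℝ, 0 < ξ ∧
      (∀ u ∈ C ∩ Metric.sphere 0 1, ξ < ⟪u, -e 0⟫) ∧
      (∀ v ∈ dualCone C ∩ Metric.sphere 0 1, ⟪v, -e 0⟫ < -ξ)

/-- The point of `ℝ^{m+1}` with coordinates `(t, x) ∈ ℝ × ℝ^m` in the orthonormal basis `e`. -/
def point (e : OrthonormalBasis (Fin (m + 1)) ℝ (EuclideanSpace ℝ (Fin (m + 1))))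
    (t : ℝ) (x : EuclideanSpace ℝ (Fin m)) : EuclideanSpace ℝ (Fin (m + 1)) :=
  t • e 0 + ∑ i : Fin m, x i • e i.succ

/-- The map `Φ(x) = (1, x) / √(1 + |x|²)` from `ℝ^m` to the open hemisphere around `e_1`. -/
def Phi (e : OrthonormalBasis (Fin (m + 1)) ℝ (EuclideanSpace ℝ (Fin (m + 1))))
    (x : EuclideanSpace ℝ (Fin m)) : EuclideanSpace ℝ (Fin (m + 1)) :=
  (√(1 + ‖x‖ ^ 2))⁻¹ • point e 1 x

/-- The open set `Φ⁻¹(Ω) ⊆ ℝ^m`. -/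
def PhiDomain (C : Set (EuclideanSpace ℝ (Fin (m + 1))))
    (e : OrthonormalBasis (Fin (m + 1)) ℝ (EuclideanSpace ℝ (Fin (m + 1)))) :
    Set (EuclideanSpace ℝ (Fin m)) :=
  Phi e ⁻¹' Omega C

/-- The transported measure, `μ̃(η) = ∫_{Φ(η)} |⟪v, e_1⟫| dμ(v)`, for Borel sets `η ⊆ Φ⁻¹(Ω)`. -/
def muTilde {C : Set (EuclideanSpace ℝ (Fin (m + 1)))}
    (e : OrthonormalBasis (Fin (m + 1)) ℝ (EuclideanSpace ℝ (Fin (m + 1))))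
    (μ : Measure (Omega C)) (η : Set (EuclideanSpace ℝ (Fin m))) : ℝ≥0∞ :=
  ∫⁻ v in {v : Omega C | (v : EuclideanSpace ℝ (Fin (m + 1))) ∈ Phi e '' η},
    ENNReal.ofReal |⟪(v : EuclideanSpace ℝ (Fin (m + 1))), e 0⟫| ∂μ

/-- The function `u(x) = h_K(1, x)`. -/
def uFun (e : OrthonormalBasis (Fin (m + 1)) ℝ (EuclideanSpace ℝ (Fin (m + 1))))
    (K : Set (EuclideanSpace ℝ (Fin (m + 1)))) (x : EuclideanSpace ℝ (Fin m)) : ℝ :=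
  supportFunction K (point e 1 x)

end Coordinates

end PseudoCone

end

open PseudoCone

open MeasureTheory Filter Topology
open scoped ENNReal RealInnerProductSpace

noncomputable section

namespace PseudoCone

variable {m : ℕ}

/-! An affine function `y ↦ u(x) + ⟪p, y - x⟫` is `y ↦ ⟪z, (1, y)⟫` for `z = (u(x) - ⟪p, x⟫, p)`. It
lies below `u` exactly when `⟪z, w⟫ ≤ h_K(w)` for all `w ∈ C°`, that is, when `z ∈ K`; and it
touches `u` at `x`, so `z` is a boundary point with normal `Φ(x)`. Hence `∂u(Ξ)` is the projection
along `e 0` of the inverse Gauss image of `Φ(Ξ)` (`IsCPseudo.iUnion_subdifferential_eq`), and the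
Monge-Ampère equation says that this projection scales area by `⟪v, e 0⟫`
(`IsCPseudo.measure_projGauss`).

No differentiability of `∂K` enters. Boundary points whose normals lie in a small set have chords
almost orthogonal to these normals, so on them the projection is nearly linear
(`measure_proj_image_bounds`). Sum over a fine partition of `Ω` and refine. The sum is legitimate
because disjoint sets of normals have projected images with null overlap; this follows from the
additivity of `S_K = μ` and the finiteness of `μ` on compact sets.

The boundary values come from asymptoticity: a boundary vector of `C°` is orthogonal to some ray of
`C`, and `K` comes arbitrarily close to that ray (`IsCAsymptotic.supportFunction_eq_zero`). -/

/-- The last `m` coordinates of a point with respect to the orthonormal basis `e`. -/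
def proj (e : OrthonormalBasis (Fin (m + 1)) ℝ (EuclideanSpace ℝ (Fin (m + 1)))) :
    EuclideanSpace ℝ (Fin (m + 1)) →ₗ[ℝ] EuclideanSpace ℝ (Fin m) where
  toFun z := WithLp.toLp 2 fun i => ⟪e i.succ, z⟫
  map_add' x y := by ext i; simp [inner_add_right]
  map_smul' c x := by ext i; simp [inner_smul_right]

/-! ### Coordinates adapted to the basis `e`. -/

section Coords

variable (e : OrthonormalBasis (Fin (m + 1)) ℝ (EuclideanSpace ℝ (Fin (m + 1))))

@[simp] theorem proj_apply (z : EuclideanSpace ℝ (Fin (m + 1))) (i : Fin m) :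
    proj e z i = ⟪e i.succ, z⟫ := rfl

theorem continuous_proj : Continuous (proj e) := (proj e).continuous_of_finiteDimensional

theorem inner_eq_coords (z w : EuclideanSpace ℝ (Fin (m + 1))) :
    ⟪z, w⟫ = ⟪z, e 0⟫ * ⟪w, e 0⟫ + ⟪proj e z, proj e w⟫ := by
  rw [← e.sum_inner_mul_inner z w, Fin.sum_univ_succ, real_inner_comm w]
  congr 1
  simp only [PiLp.inner_apply, proj_apply]
  refine Finset.sum_congr rfl fun i _ => ?_
  simp [mul_comm]

theorem norm_sq_eq_coords (z : EuclideanSpace ℝ (Fin (m + 1))) :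
    ‖z‖ ^ 2 = ⟪z, e 0⟫ ^ 2 + ‖proj e z‖ ^ 2 := by
  rw [← real_inner_self_eq_norm_sq, inner_eq_coords e, real_inner_self_eq_norm_sq, ← sq]

theorem norm_proj_le (z : EuclideanSpace ℝ (Fin (m + 1))) : ‖proj e z‖ ≤ ‖z‖ := by
  refine (sq_le_sq₀ (norm_nonneg _) (norm_nonneg _)).1 ?_
  nlinarith [norm_sq_eq_coords e z, sq_nonneg ⟪z, e 0⟫]

@[simp] theorem inner_point (t : ℝ) (x : EuclideanSpace ℝ (Fin m)) :
    ⟪point e t x, e 0⟫ = t := by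
  simp [point, inner_add_left, inner_smul_left, sum_inner, e.inner_eq_ite]

@[simp] theorem proj_point (t : ℝ) (x : EuclideanSpace ℝ (Fin m)) :
    proj e (point e t x) = x := by
  ext i
  simp [point, e.inner_eq_ite, (Fin.succ_ne_zero _)]

theorem point_proj (z : EuclideanSpace ℝ (Fin (m + 1))) :
    point e ⟪z, e 0⟫ (proj e z) = z := by
  rw [← sub_eq_zero, ← norm_eq_zero, ← sq_eq_zero_iff, norm_sq_eq_coords e]
  simp [inner_sub_left]

theorem point_sub_eq (s : ℝ) (z : EuclideanSpace ℝ (Fin (m + 1))) :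
    point e s (proj e z) - z = (s - ⟪z, e 0⟫) • e 0 := by
  nth_rw 2 [← point_proj e z]
  simp only [point, sub_smul]
  abel

theorem inner_point_right (z : EuclideanSpace ℝ (Fin (m + 1))) (t : ℝ)
    (x : EuclideanSpace ℝ (Fin m)) :
    ⟪z, point e t x⟫ = ⟪z, e 0⟫ * t + ⟪proj e z, x⟫ := by
  rw [inner_eq_coords e]; simp

theorem norm_sq_point (t : ℝ) (x : EuclideanSpace ℝ (Fin m)) :
    ‖point e t x‖ ^ 2 = t ^ 2 + ‖x‖ ^ 2 := by
  rw [norm_sq_eq_coords e]; simp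

theorem continuous_point (t : ℝ) : Continuous (point e t) := by
  unfold point; fun_prop

theorem point_smul (c t : ℝ) (x : EuclideanSpace ℝ (Fin m)) :
    point e (c * t) (c • x) = c • point e t x := by
  simp [point, smul_smul, Finset.smul_sum]

theorem point_combo (a b : ℝ) (s t : ℝ) (x y : EuclideanSpace ℝ (Fin m)) :
    point e (a * s + b * t) (a • x + b • y) = a • point e s x + b • point e t y := by
  rw [← point_smul, ← point_smul]
  simp only [point, PiLp.add_apply, add_smul, Finset.sum_add_distrib]
  abel

end Coords

/-! ### Area distortion of the projection along `e 0`. -/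

/-- The rank-one perturbation of the identity with `‖stretch b p‖² = ‖p‖² + ⟪b, p⟫²`: it has the
same metric as the graph of the linear function `p ↦ ⟪b, p⟫`. -/
def stretch (b : EuclideanSpace ℝ (Fin m)) :
    EuclideanSpace ℝ (Fin m) →ₗ[ℝ] EuclideanSpace ℝ (Fin m) :=
  LinearMap.transvection ((1 + √(1 + ‖b‖ ^ 2))⁻¹ • innerₛₗ ℝ b) b

theorem stretch_apply (b p : EuclideanSpace ℝ (Fin m)) :
    stretch b p = p + ((1 + √(1 + ‖b‖ ^ 2))⁻¹ * ⟪b, p⟫) • b := by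
  simp [stretch, LinearMap.transvection.apply]

theorem norm_sq_stretch (b p : EuclideanSpace ℝ (Fin m)) :
    ‖stretch b p‖ ^ 2 = ‖p‖ ^ 2 + ⟪b, p⟫ ^ 2 := by
  have hq : √(1 + ‖b‖ ^ 2) ^ 2 = 1 + ‖b‖ ^ 2 := Real.sq_sqrt (by positivity)
  have hq0 : 0 ≤ √(1 + ‖b‖ ^ 2) := Real.sqrt_nonneg _
  rw [stretch_apply, norm_add_sq_real, norm_smul, inner_smul_right, real_inner_comm b p,
    mul_pow, Real.norm_eq_abs, sq_abs]
  -- With `c = 1 / (1 + q)`, the coefficient of `⟪b, p⟫ ^ 2` is `2 * c + c ^ 2 * (q ^ 2 - 1) = 1`.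
  have hb : ‖b‖ ^ 2 = √(1 + ‖b‖ ^ 2) ^ 2 - 1 := by linarith
  generalize √(1 + ‖b‖ ^ 2) = q at *
  rw [hb]
  have : 1 + q ≠ 0 := by positivity
  field_simp
  ring

theorem det_stretch (b : EuclideanSpace ℝ (Fin m)) :
    LinearMap.det (stretch b) = √(1 + ‖b‖ ^ 2) := by
  have hq : √(1 + ‖b‖ ^ 2) ^ 2 = 1 + ‖b‖ ^ 2 := Real.sq_sqrt (by positivity)
  have hq0 : 0 ≤ √(1 + ‖b‖ ^ 2) := Real.sqrt_nonneg _
  rw [stretch, LinearMap.transvection.det]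
  simp only [LinearMap.smul_apply, innerₛₗ_apply_apply, real_inner_self_eq_norm_sq, smul_eq_mul]
  have hb : ‖b‖ ^ 2 = √(1 + ‖b‖ ^ 2) ^ 2 - 1 := by linarith
  generalize √(1 + ‖b‖ ^ 2) = q at *
  rw [hb]
  have : 1 + q ≠ 0 := by positivity
  field_simp
  ring

theorem euclideanHausdorffMeasure_stretch_image (b : EuclideanSpace ℝ (Fin m))
    (S : Set (EuclideanSpace ℝ (Fin m))) :
    μHE[m] (stretch b '' S) = ENNReal.ofReal √(1 + ‖b‖ ^ 2) * μHE[m] S := by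
  have h := EuclideanSpace.euclideanHausdorffMeasure_eq_volume m
  have h1 := congrArg (fun ν => ν (stretch b '' S)) h
  have h2 := congrArg (fun ν => ν S) h
  have h3 := Measure.addHaar_image_linearMap volume (stretch b) S
  rw [det_stretch, abs_of_nonneg (Real.sqrt_nonneg _)] at h3
  exact h1.trans (h3.trans (congrArg _ h2.symm))

section Hausdorff

variable {X Y : Type*} [EMetricSpace X] [MeasurableSpace X] [BorelSpace X]
  [EMetricSpace Y] [MeasurableSpace Y] [BorelSpace Y]

theorem euclideanHausdorffMeasure_image_le {f : X → Y} {A : Set X} {L : NNReal}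
    (h : LipschitzOnWith L f A) (d : ℕ) : μHE[d] (f '' A) ≤ (L : ℝ≥0∞) ^ d * μHE[d] A := by
  simp only [Measure.euclideanHausdorffMeasure_def, Measure.smul_apply]
  have := h.hausdorffMeasure_image_le (d := d) (by positivity)
  rw [ENNReal.rpow_natCast] at this
  rw [mul_smul_comm]
  gcongr

end Hausdorff

theorem euclideanHausdorffMeasure_image_le_of_dist {E F : Type*} [NormedAddCommGroup E]
    [MeasurableSpace E] [BorelSpace E] [NormedAddCommGroup F] [MeasurableSpace F] [BorelSpace F]
    {f : E → F} {A : Set E} {L : ℝ} (hL : 0 ≤ L)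
    (h : ∀ x ∈ A, ∀ y ∈ A, ‖f x - f y‖ ≤ L * ‖x - y‖) (d : ℕ) :
    μHE[d] (f '' A) ≤ ENNReal.ofReal (L ^ d) * μHE[d] A := by
  rw [ENNReal.ofReal_pow hL]
  refine euclideanHausdorffMeasure_image_le (L := L.toNNReal) ?_ d
  refine LipschitzOnWith.of_dist_le_mul fun x hx y hy => ?_
  rw [dist_eq_norm, dist_eq_norm, Real.coe_toNNReal _ hL]
  exact h x hx y hy

/-- The expansion bound makes `f` injective on `A` with a `c⁻¹`-Lipschitz inverse, to which the
upper bound applies. -/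
theorem le_euclideanHausdorffMeasure_image_of_dist {E F : Type*} [NormedAddCommGroup E]
    [MeasurableSpace E] [BorelSpace E] [NormedAddCommGroup F] [MeasurableSpace F] [BorelSpace F]
    {f : E → F} {A : Set E} {c : ℝ} (hc : 0 < c)
    (h : ∀ x ∈ A, ∀ y ∈ A, c * ‖x - y‖ ≤ ‖f x - f y‖) (d : ℕ) :
    ENNReal.ofReal (c ^ d) * μHE[d] A ≤ μHE[d] (f '' A) := by
  have hinj : Set.InjOn f A := fun x hx y hy hxy => by
    have := h x hx y hy
    rw [hxy, sub_self, norm_zero] at this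
    have h0 : ‖x - y‖ ≤ 0 := by
      by_contra! h0
      nlinarith [mul_pos hc h0]
    exact sub_eq_zero.1 (norm_le_zero_iff.1 h0)
  have hA : Function.invFunOn f A '' (f '' A) = A := hinj.invFunOn_image subset_rfl
  have key := euclideanHausdorffMeasure_image_le_of_dist (f := Function.invFunOn f A)
    (A := f '' A) (L := c⁻¹) (by positivity) (by
      rintro _ ⟨x, hx, rfl⟩ _ ⟨y, hy, rfl⟩
      rw [hinj.leftInvOn_invFunOn hx, hinj.leftInvOn_invFunOn hy, inv_mul_eq_div, le_div_iff₀ hc,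
        mul_comm]
      exact h x hx y hy) d
  rw [hA] at key
  calc _ ≤ ENNReal.ofReal (c ^ d) * (ENNReal.ofReal (c⁻¹ ^ d) * μHE[d] (f '' A)) := by gcongr
    _ = _ := by
      rw [← mul_assoc, ← ENNReal.ofReal_mul (by positivity), ← mul_pow, mul_inv_cancel₀ hc.ne']
      simp

/-- On a set whose chords are almost orthogonal to the unit vector `v`, projecting along `e 0`
scales Hausdorff measure by approximately `⟪v, e 0⟫`. -/
theorem measure_proj_image_bounds
    (e : OrthonormalBasis (Fin (m + 1)) ℝ (EuclideanSpace ℝ (Fin (m + 1))))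
    {v : EuclideanSpace ℝ (Fin (m + 1))} (hv : ‖v‖ = 1) {κ : ℝ} (hκ : 0 < κ) (hκ1 : κ < 1)
    (hv0 : 0 < ⟪v, e 0⟫) {A : Set (EuclideanSpace ℝ (Fin (m + 1)))}
    (hA : ∀ x ∈ A, ∀ y ∈ A, |⟪x - y, v⟫| ≤ κ * ⟪v, e 0⟫ * ‖x - y‖) :
    μHE[m] (proj e '' A) ≤ ENNReal.ofReal ((1 + κ) ^ m * ⟪v, e 0⟫) * μHE[m] A ∧
    ENNReal.ofReal ((1 - κ) ^ m * ⟪v, e 0⟫) * μHE[m] A ≤ μHE[m] (proj e '' A) := by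
  set v0 := ⟪v, e 0⟫ with hv0'
  -- The hyperplane `v^⊥` is the graph of `p ↦ -⟪b, p⟫`, so `stretch b` carries its metric, and its
  -- determinant is `v0⁻¹`.
  set b := v0⁻¹ • proj e v with hb
  have hdet : √(1 + ‖b‖ ^ 2) = v0⁻¹ := by
    rw [Real.sqrt_eq_iff_eq_sq (by positivity) (by positivity), hb, norm_smul, mul_pow]
    have := norm_sq_eq_coords e v
    rw [hv] at this
    rw [Real.norm_eq_abs, sq_abs]
    field_simp
    linarith
  have key : ∀ x ∈ A, ∀ y ∈ A, |‖stretch b (proj e x) - stretch b (proj e y)‖ - ‖x - y‖|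
      ≤ κ * ‖x - y‖ := by
    intro x hx y hy
    rw [← map_sub, ← map_sub]
    set d := x - y with hd
    -- This is the length of the chord `d` slid along `e 0` into `v^⊥`; the slide has length `|⟪d,
    -- v⟫| / v0`, at most `κ * ‖d‖`.
    have h1 : ‖stretch b (proj e d)‖ = ‖point e (-⟪b, proj e d⟫) (proj e d)‖ := by
      rw [← sq_eq_sq₀ (norm_nonneg _) (norm_nonneg _), norm_sq_stretch, norm_sq_point]
      ring
    rw [h1]
    refine (abs_norm_sub_norm_le _ _).trans ?_
    have h2 : point e (-⟪b, proj e d⟫) (proj e d) - d = (-(⟪d, v⟫ / v0)) • e 0 := by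
      rw [point_sub_eq, inner_eq_coords e d v, hb, inner_smul_left, real_inner_comm (proj e v)]
      congr 1
      simp only [RCLike.conj_to_real]
      field_simp
      ring
    rw [h2, norm_smul, e.norm_eq_one, mul_one, norm_neg, norm_div, Real.norm_eq_abs,
      Real.norm_eq_abs, abs_of_pos hv0, div_le_iff₀ hv0]
    linarith [hA x hx y hy]
  have himg : μHE[m] ((fun z => stretch b (proj e z)) '' A)
      = ENNReal.ofReal v0⁻¹ * μHE[m] (proj e '' A) := by
    rw [← Set.image_image, euclideanHausdorffMeasure_stretch_image, hdet]
  have hcancel : ∀ M : ℝ≥0∞, ENNReal.ofReal v0 * (ENNReal.ofReal v0⁻¹ * M) = M := fun M => by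
    rw [← mul_assoc, ← ENNReal.ofReal_mul hv0.le, mul_inv_cancel₀ hv0.ne', ENNReal.ofReal_one,
      one_mul]
  constructor
  · have := euclideanHausdorffMeasure_image_le_of_dist (f := fun z => stretch b (proj e z))
      (A := A) (L := 1 + κ) (by positivity)
      (fun x hx y hy => by linarith [abs_le.1 (key x hx y hy)]) m
    rw [himg] at this
    rw [← hcancel (μHE[m] (proj e '' A)), mul_comm ((1 + κ) ^ m), ENNReal.ofReal_mul hv0.le,
      mul_assoc]
    gcongr
  · have := le_euclideanHausdorffMeasure_image_of_dist (f := fun z => stretch b (proj e z))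
      (A := A) (c := 1 - κ) (by linarith)
      (fun x hx y hy => by linarith [abs_le.1 (key x hx y hy)]) m
    rw [himg] at this
    rw [← hcancel (μHE[m] (proj e '' A)), mul_comm ((1 - κ) ^ m), ENNReal.ofReal_mul hv0.le,
      mul_assoc]
    gcongr

/-! ### Support functions and inverse Gauss images. -/

section Support

variable {E : Type*} [NormedAddCommGroup E] [InnerProductSpace ℝ E] {C K : Set E}

theorem isClosed_dualCone (C : Set E) : IsClosed (dualCone C) := by
  have : dualCone C = ⋂ x ∈ C, {y | ⟪x, y⟫ ≤ 0} := by
    ext y; simp [dualCone]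
  rw [this]
  exact isClosed_biInter fun x _ => isClosed_le (by fun_prop) continuous_const

theorem smul_mem_dualCone {y : E} (hy : y ∈ dualCone C) {r : ℝ} (hr : 0 ≤ r) :
    r • y ∈ dualCone C := fun x hx => by
  rw [inner_smul_right]
  exact mul_nonpos_of_nonneg_of_nonpos hr (hy x hx)

theorem convex_dualCone (C : Set E) : Convex ℝ (dualCone C) := by
  intro y hy z hz a b ha hb _ x hx
  rw [inner_add_right, inner_smul_right, inner_smul_right]
  nlinarith [mul_nonneg ha (neg_nonneg.2 (hy x hx)), mul_nonneg hb (neg_nonneg.2 (hz x hx))]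

/-- For `x, y ∈ K`, the point `x + r • y` is a convex combination of `x` and `y` dilated by `1 + r`.
-/
theorem IsCPseudo.subset (hK : IsCPseudo C K) : K ⊆ C := by
  intro y hy
  rw [← hK.2]
  intro x hx r hr
  have := hK.1.smul_mem _ (hK.1.convex hx hy (a := 1 / (1 + r)) (b := r / (1 + r))
    (by positivity) (by positivity) (by field_simp)) (1 + r) (by linarith)
  have h0 : 1 + r ≠ 0 := by positivity
  rwa [smul_add, smul_smul, smul_smul, mul_div_cancel₀ _ h0, mul_div_cancel₀ _ h0, one_smul] at this

theorem IsCPseudo.add_mem (hK : IsCPseudo C K) {x y : E} (hx : x ∈ K) (hy : y ∈ C) :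
    x + y ∈ K := by
  rw [← hK.2] at hy
  simpa using hy x hx 1 le_rfl

theorem IsCPseudo.inner_nonpos (hK : IsCPseudo C K) {x v : E} (hx : x ∈ K)
    (hv : v ∈ dualCone C) : ⟪x, v⟫ ≤ 0 := hv x (hK.subset hx)

theorem IsCPseudo.inner_le_supportFunction (hK : IsCPseudo C K) {x v : E} (hx : x ∈ K)
    (hv : v ∈ dualCone C) : ⟪x, v⟫ ≤ supportFunction K v :=
  le_csSup ⟨0, by rintro _ ⟨y, hy, rfl⟩; exact hK.inner_nonpos hy hv⟩ ⟨x, hx, rfl⟩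

theorem IsPseudoCone.supportFunction_le (hK : IsPseudoCone K) {v : E} {a : ℝ}
    (h : ∀ x ∈ K, ⟪x, v⟫ ≤ a) : supportFunction K v ≤ a :=
  csSup_le (hK.nonempty.image _) (by rintro _ ⟨y, hy, rfl⟩; exact h y hy)

theorem IsCPseudo.supportFunction_nonpos (hK : IsCPseudo C K) {v : E}
    (hv : v ∈ dualCone C) : supportFunction K v ≤ 0 :=
  hK.1.supportFunction_le fun _ hx => hK.inner_nonpos hx hv

theorem IsPseudoCone.exists_lt_inner (hK : IsPseudoCone K) {v : E} {a : ℝ}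
    (h : a < supportFunction K v) : ∃ x ∈ K, a < ⟪x, v⟫ := by
  by_contra! hc
  exact absurd (hK.supportFunction_le hc) (not_le.2 h)

theorem IsCPseudo.inner_eq_supportFunction_iff (hK : IsCPseudo C K) {x v : E} (hx : x ∈ K)
    (hv : v ∈ dualCone C) : ⟪x, v⟫ = supportFunction K v ↔ ∀ y ∈ K, ⟪y, v⟫ ≤ ⟪x, v⟫ :=
  ⟨fun h _ hy => h ▸ hK.inner_le_supportFunction hy hv, fun h =>
    (hK.inner_le_supportFunction hx hv).antisymm (hK.1.supportFunction_le h)⟩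

theorem IsPseudoCone.frontier_subset (hK : IsPseudoCone K) : frontier K ⊆ K :=
  hK.isClosed.frontier_subset

theorem mem_frontier_of_forall_inner_le {x v : E} (hx : x ∈ K) (hv : v ≠ 0)
    (h : ∀ y ∈ K, ⟪y, v⟫ ≤ ⟪x, v⟫) : x ∈ frontier K := by
  refine ⟨subset_closure hx, fun hi => ?_⟩
  have ht : Tendsto (fun t : ℝ => x + t • v) (𝓝[>] 0) (𝓝 x) := by
    have : Continuous fun t : ℝ => x + t • v := by fun_prop
    simpa using (this.tendsto 0).mono_left nhdsWithin_le_nhds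
  obtain ⟨t, htK, ht0⟩ := ((ht.eventually (mem_interior_iff_mem_nhds.1 hi)).and
    self_mem_nhdsWithin).exists
  have := h _ htK
  rw [inner_add_left, inner_smul_left, real_inner_self_eq_norm_sq] at this
  have h2 : 0 < t * ‖v‖ ^ 2 := mul_pos ht0 (by positivity)
  simp at this
  linarith

theorem IsCPseudo.inner_sub_nonpos (hK : IsCPseudo C K) {x v y : E} (hx : x ∈ K)
    (hv : v ∈ dualCone C) (h : ⟪x, v⟫ = supportFunction K v) (hy : y ∈ K) : ⟪y - x, v⟫ ≤ 0 := by
  rw [inner_sub_left]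
  linarith [(hK.inner_eq_supportFunction_iff hx hv).1 h y hy]

theorem Omega_subset_dualCone : Omega C ⊆ dualCone C := fun _ h => interior_subset h.1

/-- The pairs (boundary point, normal) form a closed set, and projection along a compact factor is a
closed map. Stating maximality pointwise over `K` avoids any continuity of the support function. -/
theorem IsCPseudo.isClosed_inverseGaussImage (hK : IsCPseudo C K) {k : Set E}
    (hk : IsCompact k) (hkC : k ⊆ dualCone C) : IsClosed (inverseGaussImage K k) := by
  have : CompactSpace k := isCompact_iff_compactSpace.1 hk
  have heq : inverseGaussImage K k =
      Prod.fst '' {p : E × k | p.1 ∈ frontier K ∧ ∀ y ∈ K, ⟪y, (p.2 : E)⟫ ≤ ⟪p.1, (p.2 : E)⟫} := by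
    ext x
    constructor
    · rintro ⟨hx, v, hv, h⟩
      exact ⟨(x, ⟨v, hv⟩),
        ⟨hx, (hK.inner_eq_supportFunction_iff (hK.1.frontier_subset hx) (hkC hv)).1 h⟩, rfl⟩
    · rintro ⟨⟨x, v⟩, ⟨hx, h⟩, rfl⟩
      exact ⟨hx, v, v.2,
        (hK.inner_eq_supportFunction_iff (hK.1.frontier_subset hx) (hkC v.2)).2 h⟩
  rw [heq]
  refine isClosedMap_fst_of_compactSpace _ ?_
  refine (isClosed_frontier.preimage continuous_fst).inter ?_
  have : {p : E × k | ∀ y ∈ K, ⟪y, (p.2 : E)⟫ ≤ ⟪p.1, (p.2 : E)⟫} =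
      ⋂ y ∈ K, {p : E × k | ⟪y, (p.2 : E)⟫ ≤ ⟪p.1, (p.2 : E)⟫} := by ext; simp
  show IsClosed {p : E × k | ∀ y ∈ K, ⟪y, (p.2 : E)⟫ ≤ ⟪p.1, (p.2 : E)⟫}
  rw [this]
  exact isClosed_biInter fun y _ => isClosed_le (by fun_prop) (by fun_prop)

theorem inverseGaussImage_iUnion {ι : Sort*} (η : ι → Set E) :
    inverseGaussImage K (⋃ i, η i) = ⋃ i, inverseGaussImage K (η i) := by
  ext x
  simp only [inverseGaussImage, Set.mem_iUnion, Set.mem_ofPred_eq]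
  exact ⟨fun ⟨hx, v, ⟨i, hi⟩, h⟩ => ⟨i, hx, v, hi, h⟩, fun ⟨i, hx, v, hi, h⟩ => ⟨hx, v, ⟨i, hi⟩, h⟩⟩

theorem inverseGaussImage_mono {η ζ : Set E} (h : η ⊆ ζ) :
    inverseGaussImage K η ⊆ inverseGaussImage K ζ :=
  fun _ ⟨hx, v, hv, hh⟩ => ⟨hx, v, h hv, hh⟩

end Support

/-! ### Additivity of the projected inverse Gauss image. -/

section ProjectedGauss

variable {C K : Set (EuclideanSpace ℝ (Fin (m + 1)))}
  (e : OrthonormalBasis (Fin (m + 1)) ℝ (EuclideanSpace ℝ (Fin (m + 1))))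

/-- The projection to `ℝ^m` of the inverse Gauss image of a set of normals in `Ω`. -/
def projGauss (K : Set (EuclideanSpace ℝ (Fin (m + 1)))) (η : Set (Omega C)) :
    Set (EuclideanSpace ℝ (Fin m)) :=
  proj e '' inverseGaussImage K (Subtype.val '' η)

theorem projGauss_iUnion {ι : Sort*} (η : ι → Set (Omega C)) :
    projGauss e K (⋃ i, η i) = ⋃ i, projGauss e K (η i) := by
  simp only [projGauss, Set.image_iUnion, inverseGaussImage_iUnion]

theorem projGauss_mono {η ζ : Set (Omega C)} (h : η ⊆ ζ) :
    projGauss e K η ⊆ projGauss e K ζ :=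
  Set.image_mono (inverseGaussImage_mono (Set.image_mono h))

theorem projGauss_union (η ζ : Set (Omega C)) :
    projGauss e K (η ∪ ζ) = projGauss e K η ∪ projGauss e K ζ := by
  simp only [Set.union_eq_iUnion, projGauss_iUnion]
  exact Set.iUnion_congr fun b => by cases b <;> rfl

instance : LocallyCompactSpace (Omega C) :=
  (isOpen_interior.isLocallyClosed.inter Metric.isClosed_sphere.isLocallyClosed).locallyCompactSpace

/-- A point with a normal of positive `e 0`-component is the highest point of `K` on its line
parallel to `e 0`. -/
theorem IsCPseudo.injOn_proj (hK : IsCPseudo C K) (hpos : ∀ v ∈ Omega C, 0 < ⟪v, e 0⟫) :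
    Set.InjOn (proj e) (inverseGaussImage K (Omega C)) := by
  have key : ∀ x ∈ inverseGaussImage K (Omega C), ∀ y ∈ inverseGaussImage K (Omega C),
      proj e x = proj e y → ⟪y, e 0⟫ ≤ ⟪x, e 0⟫ := by
    rintro x ⟨hx, v, hv, hxv⟩ y ⟨hy, -⟩ hxy
    have h := hK.inner_sub_nonpos (hK.1.frontier_subset hx) (Omega_subset_dualCone hv) hxv
      (hK.1.frontier_subset hy)
    rw [inner_eq_coords e, map_sub, hxy, sub_self, inner_zero_left, add_zero, inner_sub_left] at h
    by_contra! hc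
    nlinarith [mul_pos (sub_pos.2 hc) (hpos v hv)]
  intro x hx y hy hxy
  rw [← point_proj e x, ← point_proj e y, hxy, (key x hx y hy hxy).antisymm (key y hy x hx hxy.symm)]

theorem image_val_subset_Omega (η : Set (Omega C)) : Subtype.val '' η ⊆ Omega C := by
  rintro _ ⟨v, -, rfl⟩; exact v.2

section Measure

variable {μ : Measure (Omega C)}

/-- Inclusion-exclusion: `S_K = μ` is additive on `k ∪ l` and finite, so the two inverse Gauss
images overlap in a null set, and projection is 1-Lipschitz. -/
theorem IsCPseudo.measure_projGauss_inter_of_isCompact [IsLocallyFiniteMeasure μ]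
    (hK : IsCPseudo C K) (hpos : ∀ v ∈ Omega C, 0 < ⟪v, e 0⟫)
    (hS : ∀ η : Set (Omega C), MeasurableSet η → surfaceArea m K (Subtype.val '' η) = μ η)
    {k l : Set (Omega C)} (hk : IsCompact k) (hl : IsCompact l) (hkl : Disjoint k l) :
    μHE[m] (projGauss e K k ∩ projGauss e K l) = 0 := by
  have hcl : ∀ {k : Set (Omega C)}, IsCompact k →
      IsClosed (inverseGaussImage K (Subtype.val '' k)) := fun hk =>
    hK.isClosed_inverseGaussImage (hk.image continuous_subtype_val)
      ((image_val_subset_Omega _).trans Omega_subset_dualCone)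
  set A := inverseGaussImage K (Subtype.val '' k) with hA
  set B := inverseGaussImage K (Subtype.val '' l) with hB
  have hAB : inverseGaussImage K (Subtype.val '' (k ∪ l)) = A ∪ B := by
    rw [Set.image_union, Set.union_eq_iUnion, inverseGaussImage_iUnion, Set.union_eq_iUnion]
    exact Set.iUnion_congr fun b => by cases b <;> rfl
  have h1 := hS k hk.measurableSet
  have h2 := hS l hl.measurableSet
  have h3 := hS (k ∪ l) (hk.measurableSet.union hl.measurableSet)
  rw [measure_union hkl hl.measurableSet, surfaceArea, hAB] at h3
  rw [surfaceArea] at h1 h2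
  have h4 := measure_union_add_inter (μ := μHE[m]) A (hcl hl).measurableSet
  rw [h1, h2, h3] at h4
  have h5 : μHE[m] (A ∩ B) = 0 := by
    have hfin : μ k + μ l ≠ ∞ := ENNReal.add_ne_top.2 ⟨hk.measure_lt_top.ne, hl.measure_lt_top.ne⟩
    exact (ENNReal.add_right_inj hfin).1 (by rw [h4, add_zero])
  rw [projGauss, projGauss, ← (hK.injOn_proj e hpos).image_inter
    (inverseGaussImage_mono (image_val_subset_Omega _))
    (inverseGaussImage_mono (image_val_subset_Omega _))]
  have h6 := euclideanHausdorffMeasure_image_le_of_dist (f := proj e) (A := A ∩ B) zero_le_one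
    (fun x _ y _ => by rw [one_mul, ← map_sub]; exact norm_proj_le e _) m
  rw [h5, mul_zero] at h6
  exact le_antisymm h6 zero_le

theorem IsCPseudo.measurableSet_projGauss_of_isCompact (hK : IsCPseudo C K) {k : Set (Omega C)}
    (hk : IsCompact k) : MeasurableSet (projGauss e K k) := by
  have h := hK.isClosed_inverseGaussImage (hk.image continuous_subtype_val)
      ((image_val_subset_Omega _).trans Omega_subset_dualCone)
  obtain ⟨L, hL, hL'⟩ := (isSigmaCompact_univ.of_isClosed_subset h (Set.subset_univ _)).image
    (continuous_proj e)
  rw [projGauss, ← hL']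
  exact MeasurableSet.iUnion fun i => (hL i).measurableSet

theorem isSigmaCompact_of_isOpen {X : Type*} [MetricSpace X] [SigmaCompactSpace X] {U : Set X}
    (hU : IsOpen U) : IsSigmaCompact U := by
  obtain ⟨F, hF, -, rfl, -⟩ := hU.exists_iUnion_isClosed
  exact isSigmaCompact_iUnion _ fun n =>
    isSigmaCompact_univ.of_isClosed_subset (hF n) (Set.subset_univ _)

/-- A boundary point may have several normals, so complements are respected only up to null sets.
The null overlap is therefore carried through the Borel induction; for open sets it reduces to
compact pairs by σ-compactness. -/
theorem IsCPseudo.nullMeasurableSet_projGauss [IsLocallyFiniteMeasure μ]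
    (hK : IsCPseudo C K) (hpos : ∀ v ∈ Omega C, 0 < ⟪v, e 0⟫)
    (hS : ∀ η : Set (Omega C), MeasurableSet η → surfaceArea m K (Subtype.val '' η) = μ η)
    {η : Set (Omega C)} (hη : MeasurableSet η) :
    NullMeasurableSet (projGauss e K η) μHE[m] ∧
      μHE[m] (projGauss e K η ∩ projGauss e K ηᶜ) = 0 := by
  induction η, hη using MeasurableSet.induction_on_open with
  | isOpen U hU =>
    obtain ⟨k, hk, hkU⟩ := isSigmaCompact_of_isOpen hU
    obtain ⟨l, hl, hlU⟩ := isSigmaCompact_univ.of_isClosed_subset hU.isClosed_compl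
      (Set.subset_univ _)
    rw [← hlU]
    nth_rw 1 [← hkU]
    nth_rw 1 [← hkU]
    rw [projGauss_iUnion, projGauss_iUnion]
    refine ⟨(MeasurableSet.iUnion fun i =>
      hK.measurableSet_projGauss_of_isCompact e (hk i)).nullMeasurableSet, ?_⟩
    rw [Set.iUnion_inter_iUnion]
    refine measure_iUnion_null fun i => measure_iUnion_null fun j =>
      hK.measure_projGauss_inter_of_isCompact e hpos hS (hk i) (hl j) ?_
    exact disjoint_compl_right.mono (hkU ▸ Set.subset_iUnion k i) (hlU ▸ Set.subset_iUnion l j)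
  | compl t ht ih =>
    rw [compl_compl, Set.inter_comm]
    refine ⟨?_, ih.2⟩
    -- Up to the null overlap, the image of `tᶜ` is the total image minus that of `t`.
    have hG : MeasurableSet (projGauss e K (Set.univ : Set (Omega C))) := by
      obtain ⟨k, hk, hkU⟩ := isSigmaCompact_univ (X := Omega C)
      rw [← hkU, projGauss_iUnion]
      exact MeasurableSet.iUnion fun i => hK.measurableSet_projGauss_of_isCompact e (hk i)
    refine (hG.nullMeasurableSet.diff ih.1).congr ?_
    have hu : projGauss e K (Set.univ : Set (Omega C)) = projGauss e K t ∪ projGauss e K tᶜ := by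
      rw [← projGauss_union, Set.union_compl_self]
    rw [hu, Set.union_sdiff_left]
    rw [← Set.sdiff_inter_self_eq_sdiff]
    exact sdiff_null_ae_eq_self ih.2
  | iUnion f hd hf ih =>
    rw [projGauss_iUnion]
    refine ⟨NullMeasurableSet.iUnion fun i => (ih i).1, ?_⟩
    rw [Set.iUnion_inter]
    refine measure_iUnion_null fun i => measure_mono_null ?_ (ih i).2
    exact Set.inter_subset_inter_right _
      (projGauss_mono e (Set.compl_subset_compl.2 (Set.subset_iUnion f i)))

theorem IsCPseudo.measure_projGauss_iUnion [IsLocallyFiniteMeasure μ]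
    (hK : IsCPseudo C K) (hpos : ∀ v ∈ Omega C, 0 < ⟪v, e 0⟫)
    (hS : ∀ η : Set (Omega C), MeasurableSet η → surfaceArea m K (Subtype.val '' η) = μ η)
    {η : ℕ → Set (Omega C)} (hη : ∀ i, MeasurableSet (η i)) (hd : Pairwise (Function.onFun Disjoint η)) :
    μHE[m] (projGauss e K (⋃ i, η i)) = ∑' i, μHE[m] (projGauss e K (η i)) := by
  rw [projGauss_iUnion]
  refine measure_iUnion₀ (fun i j hij => ?_)
    fun i => (hK.nullMeasurableSet_projGauss e hpos hS (hη i)).1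
  exact measure_mono_null (Set.inter_subset_inter_right _
    (projGauss_mono e (hd hij).subset_compl_left))
    (hK.nullMeasurableSet_projGauss e hpos hS (hη i)).2

end Measure

end ProjectedGauss

/-! ### The area formula by partition and refinement. -/

section AreaFormula

variable {C K : Set (EuclideanSpace ℝ (Fin (m + 1)))}
  (e : OrthonormalBasis (Fin (m + 1)) ℝ (EuclideanSpace ℝ (Fin (m + 1))))
  {μ : Measure (Omega C)}

/-- If `w` is a normal at `y`, then `⟪x - y, w⟫ ≤ 0`, and replacing `w` by `v` costs `ε * ‖x - y‖`.
Exchanging `x` and `y` gives the other sign. -/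
theorem IsCPseudo.abs_inner_chord_le (hK : IsCPseudo C K) {η : Set (EuclideanSpace ℝ (Fin (m + 1)))}
    (hη : η ⊆ dualCone C) {v : EuclideanSpace ℝ (Fin (m + 1))} {ε : ℝ}
    (hv : ∀ w ∈ η, ‖v - w‖ ≤ ε) :
    ∀ x ∈ inverseGaussImage K η, ∀ y ∈ inverseGaussImage K η, |⟪x - y, v⟫| ≤ ε * ‖x - y‖ := by
  have key : ∀ x ∈ inverseGaussImage K η, ∀ y ∈ inverseGaussImage K η,
      ⟪x - y, v⟫ ≤ ε * ‖x - y‖ := by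
    rintro x ⟨hx, -⟩ y ⟨hy, w, hw, hyw⟩
    have h1 := hK.inner_sub_nonpos (hK.1.frontier_subset hy) (hη hw) hyw (hK.1.frontier_subset hx)
    have h2 : ⟪x - y, v - w⟫ ≤ ε * ‖x - y‖ := by
      refine (real_inner_le_norm _ _).trans ?_
      rw [mul_comm]
      gcongr
      exact hv w hw
    rw [inner_sub_right] at h2
    linarith
  intro x hx y hy
  refine abs_le.2 ⟨?_, key x hx y hy⟩
  have := key y hy x hx
  rw [← neg_sub x y, inner_neg_left, norm_neg] at this
  linarith

/-- As `ξ < ⟪v, e 0⟫`, diameter `κ * ξ` makes both the tilt of chords and the oscillation of `⟪·, e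
0⟫` at most `κ` relative to `⟪v, e 0⟫`. One factor `1 ± κ` comes from the oscillation, the `m`-th
power from the Lipschitz bounds. -/
theorem IsCPseudo.projGauss_bounds_of_diam (hK : IsCPseudo C K) {ξ : ℝ} (hξ : 0 < ξ)
    (hpos : ∀ v ∈ Omega C, ξ < ⟪v, e 0⟫)
    (hS : ∀ η : Set (Omega C), MeasurableSet η → surfaceArea m K (Subtype.val '' η) = μ η)
    {κ : ℝ} (hκ : 0 < κ) (hκ1 : κ < 1) {η : Set (Omega C)} (hη : MeasurableSet η)
    (hdiam : ∀ v ∈ η, ∀ w ∈ η, dist v w ≤ κ * ξ) :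
    ENNReal.ofReal ((1 - κ) ^ m) *
        ∫⁻ v in η, ENNReal.ofReal |⟪(v : EuclideanSpace ℝ (Fin (m + 1))), e 0⟫| ∂μ
      ≤ ENNReal.ofReal (1 + κ) * μHE[m] (projGauss e K η) ∧
    ENNReal.ofReal (1 - κ) * μHE[m] (projGauss e K η) ≤ ENNReal.ofReal ((1 + κ) ^ m) *
        ∫⁻ v in η, ENNReal.ofReal |⟪(v : EuclideanSpace ℝ (Fin (m + 1))), e 0⟫| ∂μ := by
  rcases η.eq_empty_or_nonempty with rfl | ⟨v, hv⟩
  · simp [projGauss, inverseGaussImage]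
  have hv0 := hpos v v.2
  have hd : ∀ w ∈ η, ‖(v : EuclideanSpace ℝ (Fin (m + 1))) - w‖ ≤ κ * ξ := fun w hw => by
    rw [← dist_eq_norm]; exact hdiam v hv w hw
  have hκv : κ * ξ ≤ κ * ⟪(v : EuclideanSpace ℝ (Fin (m + 1))), e 0⟫ := by gcongr
  obtain ⟨h1, h2⟩ := measure_proj_image_bounds e (v := v) (by simpa using v.2.2) hκ hκ1
    (hξ.trans hv0) (A := inverseGaussImage K (Subtype.val '' η)) (fun x hx y hy =>
      (hK.abs_inner_chord_le ((image_val_subset_Omega η).trans Omega_subset_dualCone)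
        (v := v) (ε := κ * ξ) (by rintro _ ⟨w, hw, rfl⟩; exact hd w hw) x hx y hy).trans
        (by gcongr))
  have h3 := hS η hη
  rw [surfaceArea] at h3
  rw [h3] at h1 h2
  have hw : ∀ w ∈ η, |⟪(w : EuclideanSpace ℝ (Fin (m + 1))), e 0⟫ -
      ⟪(v : EuclideanSpace ℝ (Fin (m + 1))), e 0⟫| ≤
      κ * ⟪(v : EuclideanSpace ℝ (Fin (m + 1))), e 0⟫ := fun w hw => by
    rw [abs_sub_comm, ← inner_sub_left]
    refine (abs_real_inner_le_norm _ _).trans ?_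
    rw [e.norm_eq_one, mul_one]
    exact (hd w hw).trans hκv
  set v0 := ⟪(v : EuclideanSpace ℝ (Fin (m + 1))), e 0⟫
  have hI1 : ∫⁻ w in η, ENNReal.ofReal |⟪(w : EuclideanSpace ℝ (Fin (m + 1))), e 0⟫| ∂μ
      ≤ ENNReal.ofReal ((1 + κ) * v0) * μ η := by
    rw [← setLIntegral_const]
    refine setLIntegral_mono' hη fun w hwη => ENNReal.ofReal_le_ofReal ?_
    rw [abs_of_pos (hξ.trans (hpos w w.2))]
    linarith [abs_le.1 (hw w hwη)]
  have hI2 : ENNReal.ofReal ((1 - κ) * v0) * μ η ≤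
      ∫⁻ w in η, ENNReal.ofReal |⟪(w : EuclideanSpace ℝ (Fin (m + 1))), e 0⟫| ∂μ := by
    rw [← setLIntegral_const]
    refine setLIntegral_mono' hη fun w hwη => ENNReal.ofReal_le_ofReal ?_
    rw [abs_of_pos (hξ.trans (hpos w w.2))]
    linarith [abs_le.1 (hw w hwη)]
  have hk : 0 ≤ 1 - κ := by linarith
  have hk' : 0 ≤ 1 + κ := by linarith
  constructor
  · calc _ ≤ ENNReal.ofReal ((1 - κ) ^ m) * (ENNReal.ofReal ((1 + κ) * v0) * μ η) := by gcongr
      _ = ENNReal.ofReal (1 + κ) * (ENNReal.ofReal ((1 - κ) ^ m * v0) * μ η) := by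
        rw [ENNReal.ofReal_mul hk', ENNReal.ofReal_mul (pow_nonneg hk m)]; ring
      _ ≤ _ := by gcongr; exact h2
  · calc _ ≤ ENNReal.ofReal (1 - κ) * (ENNReal.ofReal ((1 + κ) ^ m * v0) * μ η) := by
          gcongr; exact h1
      _ = ENNReal.ofReal ((1 + κ) ^ m) * (ENNReal.ofReal ((1 - κ) * v0) * μ η) := by
        rw [ENNReal.ofReal_mul hk, ENNReal.ofReal_mul (pow_nonneg hk' m)]; ring
      _ ≤ _ := by gcongr

theorem exists_measurable_partition_dist_le (X : Type*) [MetricSpace X]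
    [TopologicalSpace.SeparableSpace X] [MeasurableSpace X] [BorelSpace X] {ε : ℝ} (hε : 0 < ε) :
    ∃ P : ℕ → Set X, (∀ i, MeasurableSet (P i)) ∧ Pairwise (Function.onFun Disjoint P) ∧
      ⋃ i, P i = Set.univ ∧ ∀ i, ∀ x ∈ P i, ∀ y ∈ P i, dist x y ≤ ε := by
  rcases isEmpty_or_nonempty X with hX | hX
  · exact ⟨fun _ => ∅, by simp, by intro i j _; simp [Function.onFun], by ext x; exact hX.elim x,
      by simp⟩
  let B : ℕ → Set X := fun n => Metric.ball (TopologicalSpace.denseSeq X n) (ε / 2)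
  refine ⟨disjointed B, fun i => MeasurableSet.disjointed (fun n => measurableSet_ball) i,
    disjoint_disjointed B, ?_, fun i x hx y hy => ?_⟩
  · rw [iUnion_disjointed]
    exact Set.eq_univ_of_forall fun x => by
      obtain ⟨n, h⟩ := (TopologicalSpace.denseRange_denseSeq X).exists_dist_lt x
        (half_pos hε)
      exact Set.mem_iUnion.2 ⟨n, h⟩
  · have h1 : dist x _ < ε / 2 := disjointed_subset B i hx
    have h2 : dist y _ < ε / 2 := disjointed_subset B i hy
    linarith [dist_triangle_right x y (TopologicalSpace.denseSeq X i)]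

theorem IsCPseudo.projGauss_bounds [IsLocallyFiniteMeasure μ] (hK : IsCPseudo C K) {ξ : ℝ}
    (hξ : 0 < ξ) (hpos : ∀ v ∈ Omega C, ξ < ⟪v, e 0⟫)
    (hS : ∀ η : Set (Omega C), MeasurableSet η → surfaceArea m K (Subtype.val '' η) = μ η)
    {κ : ℝ} (hκ : 0 < κ) (hκ1 : κ < 1) {η : Set (Omega C)} (hη : MeasurableSet η) :
    ENNReal.ofReal ((1 - κ) ^ m) *
        ∫⁻ v in η, ENNReal.ofReal |⟪(v : EuclideanSpace ℝ (Fin (m + 1))), e 0⟫| ∂μ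
      ≤ ENNReal.ofReal (1 + κ) * μHE[m] (projGauss e K η) ∧
    ENNReal.ofReal (1 - κ) * μHE[m] (projGauss e K η) ≤ ENNReal.ofReal ((1 + κ) ^ m) *
        ∫⁻ v in η, ENNReal.ofReal |⟪(v : EuclideanSpace ℝ (Fin (m + 1))), e 0⟫| ∂μ := by
  obtain ⟨P, hP, hPd, hPu, hPε⟩ := exists_measurable_partition_dist_le (Omega C) (mul_pos hκ hξ)
  have hm : ∀ i, MeasurableSet (η ∩ P i) := fun i => hη.inter (hP i)
  have hd : Pairwise (Function.onFun Disjoint fun i => η ∩ P i) := fun i j hij =>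
    (hPd hij).mono Set.inter_subset_right Set.inter_subset_right
  have hu : η = ⋃ i, η ∩ P i := by rw [← Set.inter_iUnion, hPu, Set.inter_univ]
  have hb := fun i => hK.projGauss_bounds_of_diam e hξ hpos hS hκ hκ1 (hm i)
    (fun v hv w hw => hPε i v hv.2 w hw.2)
  rw [hu, hK.measure_projGauss_iUnion e (fun v hv => hξ.trans (hpos v hv)) hS hm hd,
    lintegral_iUnion hm hd, ← ENNReal.tsum_mul_left, ← ENNReal.tsum_mul_left,
    ← ENNReal.tsum_mul_left, ← ENNReal.tsum_mul_left]
  exact ⟨ENNReal.tsum_le_tsum fun i => (hb i).1, ENNReal.tsum_le_tsum fun i => (hb i).2⟩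

/-- The area formula for the projection of the boundary of `K` along the first basis vector. -/
theorem IsCPseudo.measure_projGauss [IsLocallyFiniteMeasure μ] (hK : IsCPseudo C K) {ξ : ℝ}
    (hξ : 0 < ξ) (hpos : ∀ v ∈ Omega C, ξ < ⟪v, e 0⟫)
    (hS : ∀ η : Set (Omega C), MeasurableSet η → surfaceArea m K (Subtype.val '' η) = μ η)
    {η : Set (Omega C)} (hη : MeasurableSet η) :
    μHE[m] (projGauss e K η) =
      ∫⁻ v in η, ENNReal.ofReal |⟪(v : EuclideanSpace ℝ (Fin (m + 1))), e 0⟫| ∂μ := by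
  have hev : ∀ᶠ κ : ℝ in 𝓝[>] 0, 0 < κ ∧ κ < 1 :=
    Ioo_mem_nhdsGT one_pos
  have hlim : ∀ {f : ℝ → ℝ} (_ : Continuous f) (_ : f 0 = 1) (M : ℝ≥0∞),
      Tendsto (fun κ => ENNReal.ofReal (f κ) * M) (𝓝[>] 0) (𝓝 M) := by
    intro f hf hf0 M
    have h1 : Tendsto (fun κ => ENNReal.ofReal (f κ)) (𝓝[>] 0) (𝓝 1) := by
      rw [← ENNReal.ofReal_one, ← hf0]
      exact ENNReal.tendsto_ofReal ((hf.tendsto 0).mono_left nhdsWithin_le_nhds)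
    -- The limit factor `1` is nonzero, so `M = ∞` is allowed.
    simpa using ENNReal.Tendsto.mul_const h1 (Or.inl one_ne_zero)
  refine le_antisymm ?_ ?_
  · exact le_of_tendsto_of_tendsto (hlim (f := fun κ => 1 - κ) (by fun_prop) (by simp) _)
      (hlim (f := fun κ => (1 + κ) ^ m) (by fun_prop) (by simp) _)
      (hev.mono fun κ h => (hK.projGauss_bounds e hξ hpos hS h.1 h.2 hη).2)
  · exact le_of_tendsto_of_tendsto (hlim (f := fun κ => (1 - κ) ^ m) (by fun_prop) (by simp) _)
      (hlim (f := fun κ => 1 + κ) (by fun_prop) (by simp) _)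
      (hev.mono fun κ h => (hK.projGauss_bounds e hξ hpos hS h.1 h.2 hη).1)

end AreaFormula

/-! ### The domain `Φ⁻¹(Ω)` and central projection. -/

section Domain

variable {C K : Set (EuclideanSpace ℝ (Fin (m + 1)))}
  (e : OrthonormalBasis (Fin (m + 1)) ℝ (EuclideanSpace ℝ (Fin (m + 1))))

open scoped Pointwise in
theorem smul_mem_interior_dualCone {y : EuclideanSpace ℝ (Fin (m + 1))}
    (hy : y ∈ interior (dualCone C)) {r : ℝ} (hr : 0 < r) : r • y ∈ interior (dualCone C) := by
  have h : r • y ∈ r • interior (dualCone C) := Set.smul_mem_smul_set hy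
  rw [← interior_smul₀ hr.ne'] at h
  refine interior_mono ?_ h
  rintro _ ⟨z, hz, rfl⟩
  exact smul_mem_dualCone hz hr.le

theorem inv_sqrt_one_add_pos (x : EuclideanSpace ℝ (Fin m)) : 0 < (√(1 + ‖x‖ ^ 2))⁻¹ := by
  positivity

theorem norm_Phi (x : EuclideanSpace ℝ (Fin m)) : ‖Phi e x‖ = 1 := by
  have h : ‖point e 1 x‖ = √(1 + ‖x‖ ^ 2) := by
    rw [eq_comm, Real.sqrt_eq_iff_eq_sq (by positivity) (by positivity), norm_sq_point]
    norm_num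
  rw [Phi, norm_smul, h, Real.norm_eq_abs, abs_of_pos (inv_sqrt_one_add_pos x)]
  exact inv_mul_cancel₀ (by positivity)

theorem mem_PhiDomain_iff {x : EuclideanSpace ℝ (Fin m)} :
    x ∈ PhiDomain C e ↔ point e 1 x ∈ interior (dualCone C) := by
  constructor
  · intro h
    have := smul_mem_interior_dualCone h.1 (r := √(1 + ‖x‖ ^ 2)) (by positivity)
    rwa [Phi, smul_smul, mul_inv_cancel₀ (by positivity), one_smul] at this
  · intro h
    exact ⟨smul_mem_interior_dualCone h (inv_sqrt_one_add_pos x), by simp [norm_Phi]⟩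

theorem isOpen_PhiDomain : IsOpen (PhiDomain C e) := by
  have : PhiDomain C e = point e 1 ⁻¹' interior (dualCone C) := by
    ext x; exact mem_PhiDomain_iff e
  rw [this]
  exact isOpen_interior.preimage (continuous_point e 1)

theorem point_one_combo {a b : ℝ} (hab : a + b = 1) (x y : EuclideanSpace ℝ (Fin m)) :
    point e 1 (a • x + b • y) = a • point e 1 x + b • point e 1 y := by
  rw [← point_combo, mul_one, mul_one, hab]

theorem convex_PhiDomain : Convex ℝ (PhiDomain C e) := by
  intro x hx y hy a b ha hb hab
  rw [mem_PhiDomain_iff] at *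
  rw [point_one_combo e hab]
  exact (convex_dualCone C).interior hx hy ha hb hab

theorem point_mem_dualCone_of_mem_closure {x : EuclideanSpace ℝ (Fin m)}
    (hx : x ∈ closure (PhiDomain C e)) : point e 1 x ∈ dualCone C :=
  closure_minimal (s := PhiDomain C e) (t := point e 1 ⁻¹' dualCone C)
    (fun y hy => (interior_subset ((mem_PhiDomain_iff e).1 hy) : point e 1 y ∈ dualCone C))
    ((isClosed_dualCone C).preimage (continuous_point e 1)) hx

/-- The segment from an interior point of the convex set `C°` to any point of it is interior except
possibly at the far end. -/
theorem mem_closure_PhiDomain {x y : EuclideanSpace ℝ (Fin m)} (hx : x ∈ PhiDomain C e)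
    (hy : point e 1 y ∈ dualCone C) : y ∈ closure (PhiDomain C e) := by
  have ht : Tendsto (fun t : ℝ => t • x + (1 - t) • y) (𝓝[>] 0) (𝓝 y) := by
    have : Continuous fun t : ℝ => t • x + (1 - t) • y := by fun_prop
    simpa using (this.tendsto 0).mono_left nhdsWithin_le_nhds
  refine mem_closure_of_tendsto ht ?_
  filter_upwards [Ioo_mem_nhdsGT one_pos] with t ht
  rw [mem_PhiDomain_iff, point_one_combo e (by ring)]
  exact (convex_dualCone C).combo_interior_self_mem_interior ((mem_PhiDomain_iff e).1 hx) hy ht.1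
    (by linarith [ht.2]) (by ring)

theorem point_one_inv_smul_proj {v : EuclideanSpace ℝ (Fin (m + 1))} (hv0 : ⟪v, e 0⟫ ≠ 0) :
    point e 1 (⟪v, e 0⟫⁻¹ • proj e v) = ⟪v, e 0⟫⁻¹ • v := by
  have h := point_smul e ⟪v, e 0⟫⁻¹ ⟪v, e 0⟫ (proj e v)
  rwa [inv_mul_cancel₀ hv0, point_proj] at h

theorem Phi_inv_smul_proj {v : EuclideanSpace ℝ (Fin (m + 1))} (hv : ‖v‖ = 1)
    (hv0 : 0 < ⟪v, e 0⟫) : Phi e (⟪v, e 0⟫⁻¹ • proj e v) = v := by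
  have h := point_one_inv_smul_proj e hv0.ne'
  have h2 : √(1 + ‖⟪v, e 0⟫⁻¹ • proj e v‖ ^ 2) = ⟪v, e 0⟫⁻¹ := by
    rw [Real.sqrt_eq_iff_eq_sq (by positivity) (by positivity), norm_smul, mul_pow,
      Real.norm_eq_abs, sq_abs]
    have := norm_sq_eq_coords e v
    rw [hv] at this
    field_simp
    linarith
  rw [Phi, h, h2, inv_inv, smul_smul, mul_inv_cancel₀ hv0.ne', one_smul]

theorem inv_smul_proj_Phi (x : EuclideanSpace ℝ (Fin m)) :
    ⟪Phi e x, e 0⟫⁻¹ • proj e (Phi e x) = x := by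
  have := inv_sqrt_one_add_pos x
  rw [Phi, inner_smul_left, map_smul, inner_point, proj_point, smul_smul,
    RCLike.conj_to_real, mul_one, inv_mul_cancel₀ this.ne', one_smul]

theorem measurableSet_mem_Phi_image (hpos : ∀ v ∈ Omega C, 0 < ⟪v, e 0⟫)
    {η : Set (EuclideanSpace ℝ (Fin m))} (hη : MeasurableSet η) :
    MeasurableSet {v : Omega C | (v : EuclideanSpace ℝ (Fin (m + 1))) ∈ Phi e '' η} := by
  have heq : {v : Omega C | (v : EuclideanSpace ℝ (Fin (m + 1))) ∈ Phi e '' η} =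
      -- Central projection `v ↦ proj e v / ⟪v, e 0⟫` inverts `Phi`, turning the image into a
      -- preimage under a continuous map.
      (fun v : Omega C => ⟪(v : EuclideanSpace ℝ (Fin (m + 1))), e 0⟫⁻¹ • proj e v) ⁻¹' η := by
    ext v
    constructor
    · rintro ⟨x, hx, hv⟩
      rw [Set.mem_preimage, ← hv, inv_smul_proj_Phi]
      exact hx
    · intro h
      have hv1 : ‖(v : EuclideanSpace ℝ (Fin (m + 1)))‖ = 1 := by simpa using v.property.2
      exact ⟨_, h, Phi_inv_smul_proj e hv1 (hpos v v.property)⟩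
  rw [heq]
  have hc : Continuous fun v : Omega C =>
      ⟪(v : EuclideanSpace ℝ (Fin (m + 1))), e 0⟫⁻¹ • proj e v := by
    have hi : Continuous fun v : Omega C => ⟪(v : EuclideanSpace ℝ (Fin (m + 1))), e 0⟫ := by
      fun_prop
    exact (hi.inv₀ fun v => (hpos v v.property).ne').smul
      ((continuous_proj e).comp continuous_subtype_val)
  exact hc.measurable hη

theorem inner_Phi (z : EuclideanSpace ℝ (Fin (m + 1))) (x : EuclideanSpace ℝ (Fin m)) :
    ⟪z, Phi e x⟫ = (√(1 + ‖x‖ ^ 2))⁻¹ * ⟪z, point e 1 x⟫ := by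
  rw [Phi, inner_smul_right]

end Domain

/-! ### Convexity, continuity and subgradients of `u`. -/

section SupportFunction

variable {C K : Set (EuclideanSpace ℝ (Fin (m + 1)))}
  (e : OrthonormalBasis (Fin (m + 1)) ℝ (EuclideanSpace ℝ (Fin (m + 1))))

theorem IsCPseudo.convexOn_uFun (hK : IsCPseudo C K) :
    ConvexOn ℝ (closure (PhiDomain C e)) (uFun e K) := by
  refine ⟨(convex_PhiDomain e).closure, fun x hx y hy a b ha hb hab => ?_⟩
  refine hK.1.supportFunction_le fun z hz => ?_
  rw [point_one_combo e hab, inner_add_right, inner_smul_right, inner_smul_right]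
  have h1 := hK.inner_le_supportFunction hz (point_mem_dualCone_of_mem_closure e hx)
  have h2 := hK.inner_le_supportFunction hz (point_mem_dualCone_of_mem_closure e hy)
  simp only [smul_eq_mul]
  exact add_le_add (mul_le_mul_of_nonneg_left h1 ha) (mul_le_mul_of_nonneg_left h2 hb)

/-- Inside, convexity on an open set suffices. At the boundary, `u` is lower semicontinuous as a
supremum of affine functions, and `u ≤ 0` gives the upper bound because the boundary value is `0`.
-/
theorem IsCPseudo.continuousOn_uFun (hK : IsCPseudo C K)
    (h0 : ∀ x ∈ frontier (PhiDomain C e), uFun e K x = 0) :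
    ContinuousOn (uFun e K) (closure (PhiDomain C e)) := by
  intro x hx
  by_cases hxD : x ∈ PhiDomain C e
  · have hc := ((hK.convexOn_uFun e).subset subset_closure (convex_PhiDomain e)).continuousOn
      (isOpen_PhiDomain e)
    exact (hc.continuousAt ((isOpen_PhiDomain e).mem_nhds hxD)).continuousWithinAt
  · have hux : uFun e K x = 0 := h0 x ⟨hx, by rwa [(isOpen_PhiDomain e).interior_eq]⟩
    refine tendsto_order.2 ⟨fun a ha => ?_, fun a ha => ?_⟩
    · obtain ⟨z, hz, haz⟩ := hK.1.exists_lt_inner ha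
      have hc : Continuous fun y => ⟪z, point e 1 y⟫ := by
        have := continuous_point e 1
        fun_prop
      filter_upwards [self_mem_nhdsWithin,
        nhdsWithin_le_nhds ((hc.tendsto x).eventually (lt_mem_nhds haz))] with y hy hay
      exact hay.trans_le (hK.inner_le_supportFunction hz (point_mem_dualCone_of_mem_closure e hy))
    · rw [hux] at ha
      filter_upwards [self_mem_nhdsWithin] with y hy
      exact (hK.supportFunction_nonpos (point_mem_dualCone_of_mem_closure e hy)).trans_lt ha

theorem IsCPseudo.mem_of_forall_inner_le (hK : IsCPseudo C K)
    {z : EuclideanSpace ℝ (Fin (m + 1))}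
    (h : ∀ w ∈ dualCone C, w ≠ 0 → ⟪z, w⟫ ≤ supportFunction K w) : z ∈ K := by
  by_contra hz
  obtain ⟨f, a, hfK, hfz⟩ := geometric_hahn_banach_closed_point hK.1.convex hK.1.isClosed hz
  set w := (InnerProductSpace.toDual ℝ (EuclideanSpace ℝ (Fin (m + 1)))).symm f with hw
  have hf : ∀ y, f y = ⟪y, w⟫ := fun y => by
    rw [real_inner_comm, hw, InnerProductSpace.toDual_symm_apply]
  simp only [hf] at hfK hfz
  obtain ⟨y, hy⟩ := hK.1.nonempty
  have hwC : w ∈ dualCone C := by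
    intro c hc
    by_contra! hcw
    rw [← hK.2] at hc
    -- The multiple of `c` is large enough to push the pairing with `w` up to `a`, against
    -- separation.
    have h1 := hfK _ (hc y hy (max 1 ((a - ⟪y, w⟫) / ⟪c, w⟫)) (le_max_left _ _))
    rw [inner_add_left, real_inner_smul_left] at h1
    have h2 := mul_le_mul_of_nonneg_right (le_max_right 1 ((a - ⟪y, w⟫) / ⟪c, w⟫)) hcw.le
    rw [div_mul_cancel₀ _ hcw.ne'] at h2
    linarith
  have hw0 : w ≠ 0 := by
    intro h0
    have := hfK y hy
    rw [h0, inner_zero_right] at this hfz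
    linarith
  linarith [h w hwC hw0, hK.1.supportFunction_le fun x hx => (hfK x hx).le]

theorem IsCPseudo.iUnion_subdifferential_eq (hK : IsCPseudo C K)
    (hpos : ∀ v ∈ dualCone C, v ≠ 0 → 0 < ⟪v, e 0⟫) {η : Set (EuclideanSpace ℝ (Fin m))}
    (hη : η ⊆ PhiDomain C e) :
    ⋃ x ∈ η, subdifferential (closure (PhiDomain C e)) (uFun e K) x =
      projGauss e K {v : Omega C | (v : EuclideanSpace ℝ (Fin (m + 1))) ∈ Phi e '' η} := by
  ext p
  simp only [Set.mem_iUnion]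
  constructor
  · rintro ⟨x, hx, hp⟩
    have hxD := hη hx
    have hxC := point_mem_dualCone_of_mem_closure e (subset_closure hxD)
    -- The point of `K` that represents the supporting affine function of slope `p` at `x`.
    set z := point e (uFun e K x - ⟪p, x⟫) p with hz
    have hin : ∀ y, ⟪z, point e 1 y⟫ = uFun e K x + ⟪p, y - x⟫ := fun y => by
      rw [hz, inner_point_right, inner_point, proj_point, inner_sub_right]; ring
    have hzK : z ∈ K := by
      refine hK.mem_of_forall_inner_le fun w hw hw0 => ?_
      have hw1 := hpos w hw hw0
      have hpt := point_one_inv_smul_proj e hw1.ne'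
      have hcl : ⟪w, e 0⟫⁻¹ • proj e w ∈ closure (PhiDomain C e) :=
        -- Every nonzero `w ∈ C°` rescales to height `1` over the closed domain, so the subgradient
        -- inequality there tests `z` against all of `C°`.
        mem_closure_PhiDomain e hxD (by
          rw [hpt]; exact smul_mem_dualCone hw (by positivity))
      have h1 := hp _ hcl
      rw [← hin, hpt, inner_smul_right, uFun, hpt] at h1
      have h2 : supportFunction K (⟪w, e 0⟫⁻¹ • w) ≤ ⟪w, e 0⟫⁻¹ * supportFunction K w :=
        hK.1.supportFunction_le fun y hy => by
          rw [inner_smul_right]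
          exact mul_le_mul_of_nonneg_left (hK.inner_le_supportFunction hy hw) (by positivity)
      exact le_of_mul_le_mul_left (h1.trans h2) (by positivity)
    have hmax : ∀ y ∈ K, ⟪y, Phi e x⟫ ≤ ⟪z, Phi e x⟫ := fun y hy => by
      rw [inner_Phi, inner_Phi]
      refine mul_le_mul_of_nonneg_left ?_ (inv_sqrt_one_add_pos x).le
      rw [hin, sub_self, inner_zero_right, add_zero]
      exact hK.inner_le_supportFunction hy hxC
    refine ⟨z, ⟨mem_frontier_of_forall_inner_le hzK ?_ hmax, Phi e x,
      ⟨⟨Phi e x, hxD⟩, ⟨x, hx, rfl⟩, rfl⟩,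
      (hK.inner_eq_supportFunction_iff hzK (Omega_subset_dualCone hxD)).2 hmax⟩, proj_point e _ _⟩
    exact norm_ne_zero_iff.1 (by rw [norm_Phi]; exact one_ne_zero)
  · rintro ⟨z, ⟨hz, _, ⟨v, ⟨x, hx, hv⟩, rfl⟩, hzv⟩, rfl⟩
    refine ⟨x, hx, fun y hy => ?_⟩
    have hzK := hK.1.frontier_subset hz
    have hxC := point_mem_dualCone_of_mem_closure e (subset_closure (hη hx))
    have hux : uFun e K x = ⟪z, point e 1 x⟫ := by
      refine ((hK.inner_eq_supportFunction_iff hzK hxC).2 fun y hy => ?_).symm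
      have h := (hK.inner_eq_supportFunction_iff hzK (Omega_subset_dualCone v.2)).1 hzv y hy
      rw [← hv, inner_Phi, inner_Phi] at h
      exact le_of_mul_le_mul_left h (inv_sqrt_one_add_pos x)
    have h := hK.inner_le_supportFunction hzK (point_mem_dualCone_of_mem_closure e hy)
    refine le_trans (le_of_eq ?_) h
    rw [hux, inner_point_right, inner_point_right, inner_sub_right]
    ring

end SupportFunction

/-! ### Vanishing of the support function on the boundary of `C°`. -/

section Boundary

variable {E : Type*} [NormedAddCommGroup E] [InnerProductSpace ℝ E]

/-- Otherwise, by compactness, `⟪·, v⟫` has a negative maximum on the unit vectors of `C`, and a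
whole ball around `v` stays in the dual cone. The vector `u` only ensures that such unit vectors
exist. -/
theorem exists_orthogonal_of_mem_dualCone_of_notMem_interior [FiniteDimensional ℝ E]
    {C : ProperCone ℝ E} {u v : E}
    (hu : u ∈ C) (hu1 : ‖u‖ = 1) (hv : v ∈ dualCone (C : Set E))
    (hvi : v ∉ interior (dualCone (C : Set E))) : ∃ w ∈ C, ‖w‖ = 1 ∧ ⟪w, v⟫ = 0 := by
  by_contra! hc
  have hS : IsCompact ((C : Set E) ∩ Metric.sphere 0 1) :=
    (isCompact_sphere (0 : E) 1).inter_left C.isClosed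
  obtain ⟨w, ⟨hwC, hw1⟩, hmax⟩ := hS.exists_isMaxOn ⟨u, hu, by simpa using hu1⟩
    (f := fun w => ⟪w, v⟫) (by fun_prop)
  have hneg : ⟪w, v⟫ < 0 := lt_of_le_of_ne (hv w hwC) (hc w hwC (by simpa using hw1))
  refine hvi (mem_interior_iff_mem_nhds.2
    (mem_of_superset (Metric.ball_mem_nhds v (neg_pos.2 hneg)) fun y hy c hcC => ?_))
  rcases eq_or_ne c 0 with rfl | hc0
  · simp
  have hcn : 0 < ‖c‖ := norm_pos_iff.2 hc0
  have h1 : ‖c‖⁻¹ • c ∈ (C : Set E) ∩ Metric.sphere 0 1 :=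
    ⟨C.smul_mem hcC (by positivity), by simp [norm_smul, hcn.ne']⟩
  have h2 : ⟪‖c‖⁻¹ • c, v⟫ ≤ ⟪w, v⟫ := hmax h1
  rw [real_inner_smul_left, inv_mul_le_iff₀ hcn] at h2
  have h3 : ⟪c, y - v⟫ ≤ ‖c‖ * ‖y - v‖ := real_inner_le_norm _ _
  rw [inner_sub_right] at h3
  rw [Metric.mem_ball, dist_eq_norm] at hy
  nlinarith

theorem IsCPseudo.exists_mem_frontier_add_smul {C : ProperCone ℝ E} {K : Set E}
    (hK : IsCPseudo (C : Set E) K) {u : E} (hu : u ∈ interior (C : Set E)) (x : E)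
    (hx : x ∉ K) : ∃ s : ℝ, 0 < s ∧ x + s • u ∈ frontier K := by
  obtain ⟨y, hy⟩ := hK.1.nonempty
  have hcont : Continuous fun s : ℝ => x + s • u := by fun_prop
  have hne : {s : ℝ | 0 ≤ s ∧ x + s • u ∈ K}.Nonempty := by
    -- If `u + t • (x - y) ∈ C`, then adding its multiple by `t⁻¹` to `y ∈ K` gives `x + t⁻¹ • u ∈
    -- K`. The least such parameter is the frontier point sought.
    have ht : Tendsto (fun t : ℝ => u + t • (x - y)) (𝓝[>] 0) (𝓝 u) := by
      have : Continuous fun t : ℝ => u + t • (x - y) := by fun_prop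
      simpa using (this.tendsto 0).mono_left nhdsWithin_le_nhds
    obtain ⟨t, htC, ht0⟩ := ((ht.eventually (mem_interior_iff_mem_nhds.1 hu)).and
      self_mem_nhdsWithin).exists
    have ht0 : 0 < t := ht0
    refine ⟨t⁻¹, by positivity, ?_⟩
    have h1 := hK.add_mem hy (C.smul_mem htC (inv_pos.2 ht0).le)
    rw [smul_add, smul_smul, inv_mul_cancel₀ ht0.ne', one_smul] at h1
    convert h1 using 1
    abel
  have hcl : IsClosed {s : ℝ | 0 ≤ s ∧ x + s • u ∈ K} :=
    isClosed_Ici.inter (hK.1.isClosed.preimage hcont)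
  have hbdd : BddBelow {s : ℝ | 0 ≤ s ∧ x + s • u ∈ K} := ⟨0, fun s hs => hs.1⟩
  obtain ⟨hs0, hsK⟩ := hcl.csInf_mem hne hbdd
  set s := sInf {s : ℝ | 0 ≤ s ∧ x + s • u ∈ K}
  have hspos : 0 < s := lt_of_le_of_ne hs0 fun h => hx (by rw [← h] at hsK; simpa using hsK)
  refine ⟨s, hspos, subset_closure hsK, fun hi => ?_⟩
  have hnhds : ∀ᶠ t in 𝓝[<] s, x + t • u ∈ K :=
    nhdsWithin_le_nhds ((hcont.tendsto s).eventually (mem_interior_iff_mem_nhds.1 hi))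
  obtain ⟨t, htK, ht0, hts⟩ := (hnhds.and (Ioo_mem_nhdsLT hspos)).exists
  exact absurd (csInf_le hbdd ⟨ht0.le, htK⟩) (not_le.2 hts)

/-- The set `w + s • ball u ρ` lies in `C` and is the ball of radius `s * ρ` about `w + s • u`. -/
theorem mul_le_infDist_frontier {C : ProperCone ℝ E} {u w : E} {ρ s : ℝ}
    (hu : Metric.ball u ρ ⊆ C) (hw : w ∈ C) (hs : 0 < s)
    (hne : (frontier (C : Set E)).Nonempty) :
    s * ρ ≤ Metric.infDist (w + s • u) (frontier (C : Set E)) := by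
  refine (Metric.le_infDist hne).2 fun y hy => ?_
  by_contra! hlt
  have hsub : Metric.ball (w + s • u) (s * ρ) ⊆ C := by
    intro z hz
    have h1 : u + s⁻¹ • (z - (w + s • u)) ∈ Metric.ball u ρ := by
      rw [Metric.mem_ball, dist_eq_norm] at *
      rw [add_sub_cancel_left, norm_smul, Real.norm_eq_abs, abs_of_pos (by positivity),
        inv_mul_lt_iff₀ hs]
      exact hz
    have h2 := C.add_mem hw (C.smul_mem (hu h1) hs.le)
    rw [smul_add, smul_smul, mul_inv_cancel₀ hs.ne', one_smul] at h2
    convert! h2 using 1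
    abel
  rw [dist_comm] at hlt
  exact hy.2 (interior_maximal hsub Metric.isOpen_ball hlt)

/-- The support function of a `C`-asymptotic set vanishes on the boundary of the dual cone. -/
theorem IsCAsymptotic.supportFunction_eq_zero [FiniteDimensional ℝ E] {C : ProperCone ℝ E}
    {K : Set E} (hK : IsCAsymptotic (C : Set E) K) {u : E} {ξ : ℝ} (hξ : 0 < ξ)
    (hu : u ∈ interior (C : Set E)) (hu1 : ‖u‖ = 1)
    (huC : ∀ w ∈ (C : Set E) ∩ Metric.sphere 0 1, ξ < ⟪w, u⟫) {v : E}
    (hv0 : v ≠ 0) (hv : v ∈ dualCone (C : Set E))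
    (hvi : v ∉ interior (dualCone (C : Set E))) : supportFunction K v = 0 := by
  refine (hK.1.supportFunction_nonpos hv).antisymm ?_
  obtain ⟨w, hwC, hw1, hwv⟩ :=
    exists_orthogonal_of_mem_dualCone_of_notMem_interior (interior_subset hu) hu1 hv hvi
  have hwf : w ∈ frontier (C : Set E) :=
    mem_frontier_of_forall_inner_le hwC hv0 fun y hy => by rw [hwv]; exact hv y hy
  obtain ⟨ρ, hρ, hball⟩ := Metric.mem_nhds_iff.1 (mem_interior_iff_mem_nhds.1 hu)
  refine le_of_forall_pos_le_add fun ε hε => ?_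
  have hM : 0 < 1 + ‖v‖ := by positivity
  -- With this threshold, the bound `s * ρ ≤ dist` yields `s * (1 + ‖v‖) < ε`.
  have hev := hK.2.eventually (gt_mem_nhds (show 0 < ε * ρ / (1 + ‖v‖) by positivity))
  rw [eventually_inf_principal, hasBasis_cobounded_norm.eventually_iff] at hev
  obtain ⟨R, -, hR⟩ := hev
  -- Far enough along the ray of `w ⊥ v` that `⟪r • w, u⟫ ≥ R`. A step `s • u` from there to the
  -- frontier of `K` is short, and the pairing with `v` is only `s * ⟪u, v⟫`.
  set r := |R| / ξ with hr
  have hr0 : 0 ≤ r := by positivity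
  by_cases hrK : r • w ∈ K
  · have := hK.1.inner_le_supportFunction hrK hv
    rw [real_inner_smul_left, hwv, mul_zero] at this
    linarith
  obtain ⟨s, hs, hsK⟩ := hK.1.exists_mem_frontier_add_smul hu (r • w) hrK
  have hnorm : R ≤ ‖r • w + s • u‖ := by
    have h1 := real_inner_le_norm (r • w + s • u) u
    rw [hu1, mul_one, inner_add_left, real_inner_smul_left, real_inner_smul_left,
      real_inner_self_eq_norm_sq, hu1] at h1
    have h2 : r * ξ ≤ r * ⟪w, u⟫ :=
      mul_le_mul_of_nonneg_left (huC w ⟨hwC, by simpa using hw1⟩).le hr0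
    rw [hr, div_mul_cancel₀ _ hξ.ne'] at h2
    linarith [le_abs_self R]
  have h1 := (mul_le_infDist_frontier hball (C.smul_mem hwC hr0) hs ⟨w, hwf⟩).trans_lt
    (hR hnorm hsK)
  have h2 : s * (1 + ‖v‖) < ε := by
    rw [mul_div_right_comm] at h1
    exact (lt_div_iff₀ hM).1 (lt_of_mul_lt_mul_right h1 hρ.le)
  have h3 := hK.1.inner_le_supportFunction (hK.1.1.frontier_subset hsK) hv
  rw [inner_add_left, real_inner_smul_left, real_inner_smul_left, hwv, mul_zero, zero_add] at h3
  have h4 := neg_le_of_abs_le (abs_real_inner_le_norm u v)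
  rw [hu1, one_mul] at h4
  nlinarith

end Boundary

end PseudoCone

end

/-! ### The main theorem. -/

theorem theorem3p4 (m : ℕ)
    (C : ProperCone ℝ (EuclideanSpace ℝ (Fin (m + 1))))
    (hCpointed : ContainsNoLine (C : Set (EuclideanSpace ℝ (Fin (m + 1)))))
    (hCint : (interior (C : Set (EuclideanSpace ℝ (Fin (m + 1))))).Nonempty)
    (e : OrthonormalBasis (Fin (m + 1)) ℝ (EuclideanSpace ℝ (Fin (m + 1))))
    (he : IsAdaptedBasis (C : Set (EuclideanSpace ℝ (Fin (m + 1)))) e)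
    (μ : Measure (Omega (C : Set (EuclideanSpace ℝ (Fin (m + 1))))))
    [IsLocallyFiniteMeasure μ]
    (K : Set (EuclideanSpace ℝ (Fin (m + 1))))
    (hK : IsCAsymptotic (C : Set (EuclideanSpace ℝ (Fin (m + 1)))) K)
    (hS : ∀ η : Set (Omega (C : Set (EuclideanSpace ℝ (Fin (m + 1))))), MeasurableSet η →
      surfaceArea m K (Subtype.val '' η) = μ η) :
    ConvexOn ℝ (closure (PhiDomain (C : Set (EuclideanSpace ℝ (Fin (m + 1)))) e)) (uFun e K) ∧
    ContinuousOn (uFun e K) (closure (PhiDomain (C : Set (EuclideanSpace ℝ (Fin (m + 1)))) e)) ∧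
    (∀ η ⊆ PhiDomain (C : Set (EuclideanSpace ℝ (Fin (m + 1)))) e, MeasurableSet η →
      mongeAmpere (closure (PhiDomain (C : Set (EuclideanSpace ℝ (Fin (m + 1)))) e))
        (uFun e K) η = muTilde e μ η) ∧
    (∀ x ∈ frontier (PhiDomain (C : Set (EuclideanSpace ℝ (Fin (m + 1)))) e), uFun e K x = 0) := by
  obtain ⟨heC, ξ, hξ, hξC, hξdual⟩ := he
  have hdual : ∀ v ∈ dualCone (C : Set (EuclideanSpace ℝ (Fin (m + 1)))), v ≠ 0 →
      0 < ⟪v, e 0⟫ := fun v hv hv0 => by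
    have hn : 0 < ‖v‖ := norm_pos_iff.2 hv0
    have h := hξdual (‖v‖⁻¹ • v)
      ⟨smul_mem_dualCone hv (by positivity), by simp [norm_smul, hn.ne']⟩
    rw [inner_neg_right, neg_lt_neg_iff, real_inner_smul_left] at h
    exact pos_of_mul_pos_right (hξ.trans h) (by positivity)
  have hΩ : ∀ v ∈ Omega (C : Set (EuclideanSpace ℝ (Fin (m + 1)))), ξ < ⟪v, e 0⟫ := fun v hv => by
    have h := hξdual v ⟨Omega_subset_dualCone hv, hv.2⟩
    rwa [inner_neg_right, neg_lt_neg_iff] at h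
  have hzero : ∀ x ∈ frontier (PhiDomain (C : Set (EuclideanSpace ℝ (Fin (m + 1)))) e),
      uFun e K x = 0 := fun x hx => by
    refine hK.supportFunction_eq_zero hξ heC (by simp) hξC ?_
      (point_mem_dualCone_of_mem_closure e hx.1) fun h => ?_
    · intro h
      have := inner_point e 1 x
      rw [h, inner_zero_left] at this
      exact zero_ne_one this
    · exact hx.2 ((isOpen_PhiDomain e).interior_eq.symm ▸ (mem_PhiDomain_iff e).2 h)
  refine ⟨hK.1.convexOn_uFun e, hK.1.continuousOn_uFun e hzero, fun η hη hηm => ?_, hzero⟩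
  rw [mongeAmpere, hK.1.iUnion_subdifferential_eq e hdual hη, muTilde]
  exact hK.1.measure_projGauss e hξ hΩ hS
    (measurableSet_mem_Phi_image e (fun v hv => hξ.trans (hΩ v hv)) hηm)
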